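/- Let $N\ge 0$ be an integer and let $\Gamma\in\mathbb{C}^{N\times N}$ be a unitary matrix with $\Gamma^2=I$ whose eigenspaces for $+1$ and $-1$ have the same dimension (so $N$ is even). Let $T>0$ and let $t\mapsto H(t)\in\mathbb{C}^{N\times N}$, $t\in\mathbb{R}$, be a locally integrable, $T$-periodic family of Hermitian matrices with the chiral symmetry $$\Gamma H(t)\Gamma=-H(-t)\qquad\text{for all } t\in\mathbb{R}.$$ Let $U(t)$ be the time evolution generated by $H(t)$, i.e. the continuous solution of $U(t)=I-i\int_0^t H(s)U(s)\,ds$ (the Schrödinger equation $iU'(t)=H(t)U(t)$, $U(0)=I$), and let $U(T)$ be the Floquet operator. Then there is a Hermitian matrix $H$ with $$\Gamma H=-H\Gamma\qquad\text{and}\qquad e^{-iH}=U(T).$$ Moreover, there are an orthonormal basis $b_1,\dots,b_N$ of $\mathbb{C}^N$, complex scalars $\lambda_1,\dots,\lambda_N$ of modulus one and real numbers $\mu_1,\dots,\mu_N$ such that, for $j=1,\dots,N$, $$U(T)b_j=\lambda_j b_j,\qquad Hb_j=\mu_j b_j,\qquad \lambda_j=e^{-i\mu_j},$$ and, for $j=1,\dots,N/2$,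 $$\Gamma b_j=b_{\frac N2+j},\qquad \overline{\lambda_j}=\lambda_{\frac N2+j},\qquad \mu_{\frac N2+j}=-\mu_j .$$ -/

import Mathlib

/-- The family `U t = U(0,t)` is the time evolution (propagator) generated by the time-dependent
Hamiltonian `H`, i.e. the solution of the Schrödinger equation `i U'(t) = H(t) U(t)`, `U(0) = 1`,
in integrated form: `U` is continuous and `U(t) = 1 - i ∫₀ᵗ H(s) U(s) ds` for every real `t`
(the integral of a matrix-valued function being taken entrywise). For locally integrable `H`
there is exactly one such `U`; for continuous `H` it is the classical solution. -/
def IsTimeEvolution {N : ℕ} (H U : ℝ → Matrix (Fin N) (Fin N) ℂ) : Prop :=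
  Continuous U ∧
    ∀ (t : ℝ) (j k : Fin N),
      U t j k = (1 : Matrix (Fin N) (Fin N) ℂ) j k
        - Complex.I * ∫ s in (0 : ℝ)..t, (H s * U s) j k

/-! ### Evolution under a locally integrable Hamiltonian, and the half-period formula. -/

section TimeEvolution

open MeasureTheory Filter

/-! Uniqueness for the Schrödinger equation turns chirality into `U(t) = Γ U(-t) Γ`; with
periodicity this gives `U(T) = Γ Fᴴ Γ F` for the half-period propagator `F = U(T/2)`
(`IsTimeEvolution.floquet_eq`). Hence `Γ U(T) = Fᴴ Γ F` is unitarily conjugate to `Γ`: both are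
involutions, and both are traceless because `Γ` is balanced.

These two traces are all that the linear algebra needs. `Γ` maps an eigenvector `v` of `U(T)` for
`λ` to one for `conj λ`, automatically orthogonal to `v` when `λ ≠ ±1`. At `λ = ±1` the traces force
both signs of `Γ` to occur equally often, so again some eigenvector satisfies `v ⊥ Γ v`. Splitting
off the plane of `v` and `Γ v` preserves both traces, and induction gives the paired basis
(`IsChiralPair.exists_eigenbasis`).

The logarithm takes opposite phases on `v` and `Γ v`. At `λ = -1` these are `-π` and `π`, so it is
not a function of `U(T)` alone. -/

theorem AbsolutelyContinuousOnInterval.of_re_im {f : ℝ → ℂ} {a b : ℝ}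
    (hre : AbsolutelyContinuousOnInterval (fun x => (f x).re) a b)
    (him : AbsolutelyContinuousOnInterval (fun x => (f x).im) a b) :
    AbsolutelyContinuousOnInterval f a b := by
  unfold AbsolutelyContinuousOnInterval at hre him ⊢
  refine squeeze_zero (fun E => Finset.sum_nonneg fun i _ => dist_nonneg) (fun E => ?_)
    (by simpa using hre.add him)
  rw [← Finset.sum_add_distrib]
  refine Finset.sum_le_sum fun i _ => ?_
  rw [Complex.dist_eq, Real.dist_eq, Real.dist_eq, ← Complex.sub_re, ← Complex.sub_im]
  exact Complex.norm_le_abs_re_add_abs_im _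

theorem AbsolutelyContinuousOnInterval.const {X : Type*} [PseudoMetricSpace X] (c : X) (a b : ℝ) :
    AbsolutelyContinuousOnInterval (fun _ => c) a b := by
  simpa [AbsolutelyContinuousOnInterval] using tendsto_const_nhds

theorem AbsolutelyContinuousOnInterval.star {f : ℝ → ℂ} {a b : ℝ}
    (hf : AbsolutelyContinuousOnInterval f a b) :
    AbsolutelyContinuousOnInterval (fun x => star (f x)) a b := by
  simpa only [AbsolutelyContinuousOnInterval, dist_star_star] using hf

theorem AbsolutelyContinuousOnInterval.finset_sum {ι F : Type*} [NormedAddCommGroup F]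
    [NormedSpace ℝ F] {f : ι → ℝ → F} {a b : ℝ} (s : Finset ι)
    (hf : ∀ i ∈ s, AbsolutelyContinuousOnInterval (f i) a b) :
    AbsolutelyContinuousOnInterval (fun x => ∑ i ∈ s, f i x) a b := by
  classical
  induction s using Finset.induction_on with
  | empty => simpa using AbsolutelyContinuousOnInterval.const (0 : F) a b
  | insert i s hi ih =>
    simp only [Finset.sum_insert hi]
    exact (hf i (by simp)).fun_add (ih fun j hj => hf j (by simp [hj]))

theorem MeasureTheory.LocallyIntegrable.absolutelyContinuousOnInterval {f : ℝ → ℂ}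
    (hf : LocallyIntegrable f) (a b : ℝ) :
    AbsolutelyContinuousOnInterval (fun x => ∫ s in a..x, f s) a b := by
  have hi (c d : ℝ) : IntervalIntegrable f volume c d :=
    (hf.integrableOn_isCompact isCompact_uIcc).intervalIntegrable
  apply AbsolutelyContinuousOnInterval.of_re_im
  · have h : IntervalIntegrable (fun s => (f s).re) volume a b :=
      ⟨(hi a b).1.re, (hi a b).2.re⟩
    convert h.absolutelyContinuousOnInterval_intervalIntegral (c := a) (by simp) using 2 with x
    exact (intervalIntegral.intervalIntegral_re (hi a x)).symm
  · have h : IntervalIntegrable (fun s => (f s).im) volume a b :=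
      ⟨(hi a b).1.im, (hi a b).2.im⟩
    convert h.absolutelyContinuousOnInterval_intervalIntegral (c := a) (by simp) using 2 with x
    exact (intervalIntegral.intervalIntegral_im (hi a x)).symm

section Evolution

variable {N : ℕ}

/-- `X` solves `i X'(t) = H(t) X(t)` with initial value `X₀` in integrated form. -/
def IsTimeEvolutionFrom (H : ℝ → Matrix (Fin N) (Fin N) ℂ) (X₀ : Matrix (Fin N) (Fin N) ℂ)
    (X : ℝ → Matrix (Fin N) (Fin N) ℂ) : Prop :=
  Continuous X ∧ ∀ (t : ℝ) (j k : Fin N),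
    X t j k = X₀ j k - Complex.I * ∫ s in (0 : ℝ)..t, (H s * X s) j k

theorem MeasureTheory.LocallyIntegrable.matrix_mul_apply {H X : ℝ → Matrix (Fin N) (Fin N) ℂ}
    (hH : ∀ j k, LocallyIntegrable (fun t => H t j k)) (hX : Continuous X) (j k : Fin N) :
    LocallyIntegrable (fun t => (H t * X t) j k) := by
  simp only [Matrix.mul_apply]
  exact locallyIntegrable_finsetSum _ fun l _ => (hH j l).mul_continuous (hX.matrix_elem l k)

namespace IsTimeEvolutionFrom

variable {H X Y : ℝ → Matrix (Fin N) (Fin N) ℂ} {X₀ Y₀ : Matrix (Fin N) (Fin N) ℂ}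

theorem apply_zero (hX : IsTimeEvolutionFrom H X₀ X) : X 0 = X₀ := by
  ext j k
  simp [hX.2 0 j k]

theorem absolutelyContinuousOnInterval (hX : IsTimeEvolutionFrom H X₀ X)
    (hH : ∀ j k, LocallyIntegrable (fun t => H t j k)) (j k : Fin N) (t : ℝ) :
    AbsolutelyContinuousOnInterval (fun s => X s j k) 0 t := by
  simp only [hX.2 _ j k]
  exact (AbsolutelyContinuousOnInterval.const _ _ _).fun_sub
    (((LocallyIntegrable.matrix_mul_apply hH hX.1 j k).absolutelyContinuousOnInterval 0
      t).const_smul Complex.I)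

theorem ae_hasDerivAt (hX : IsTimeEvolutionFrom H X₀ X)
    (hH : ∀ j k, LocallyIntegrable (fun t => H t j k)) :
    ∀ᵐ t : ℝ, ∀ j k, HasDerivAt (fun s => X s j k) (-Complex.I * (H t * X t) j k) t := by
  rw [ae_all_iff]; intro j
  rw [ae_all_iff]; intro k
  filter_upwards [LocallyIntegrable.ae_hasDerivAt_integral
    (LocallyIntegrable.matrix_mul_apply hH hX.1 j k)]
    with t ht
  simp only [hX.2 _ j k]
  simpa using ((ht 0).const_mul Complex.I).const_sub (X₀ j k)

/-- For Hermitian `H`, the product `X(t)ᴴ Y(t)` of two solutions is a constant of motion. -/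
theorem conjTranspose_mul (hX : IsTimeEvolutionFrom H X₀ X) (hY : IsTimeEvolutionFrom H Y₀ Y)
    (hH : ∀ j k, LocallyIntegrable (fun t => H t j k)) (hherm : ∀ t, (H t).IsHermitian) (t : ℝ) :
    (X t).conjTranspose * Y t = X₀.conjTranspose * Y₀ := by
  ext j k
  have hac : AbsolutelyContinuousOnInterval (fun s => ((X s).conjTranspose * Y s) j k) 0 t := by
    simp only [Matrix.mul_apply, Matrix.conjTranspose_apply]
    exact AbsolutelyContinuousOnInterval.finset_sum _ fun l _ =>
      (hX.absolutelyContinuousOnInterval hH l j t).star.fun_smul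
        (hY.absolutelyContinuousOnInterval hH l k t)
  have hderiv : ∀ᵐ s : ℝ, HasDerivAt (fun s => ((X s).conjTranspose * Y s) j k) 0 s := by
    filter_upwards [hX.ae_hasDerivAt hH, hY.ae_hasDerivAt hH] with s hXs hYs
    have h := HasDerivAt.fun_sum (u := Finset.univ) fun l _ => (hXs l j).star.fun_mul (hYs l k)
    simp only [Matrix.mul_apply, Matrix.conjTranspose_apply]
    refine h.congr_deriv ?_
    have e : (H s * X s).conjTranspose * Y s = (X s).conjTranspose * (H s * Y s) := by
      rw [Matrix.conjTranspose_mul, (hherm s).eq, Matrix.mul_assoc]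
    have e' := congrFun (congrFun e j) k
    rw [Matrix.mul_apply, Matrix.mul_apply] at e'
    simp only [Matrix.conjTranspose_apply] at e'
    rw [Finset.sum_add_distrib]
    have h1 : ∀ l, star (-Complex.I * (H s * X s) l j) * Y s l k
        = Complex.I * (star ((H s * X s) l j) * Y s l k) := fun l => by
      simp [mul_assoc]
    have h2 : ∀ l, star (X s l j) * (-Complex.I * (H s * Y s) l k)
        = -Complex.I * (star (X s l j) * (H s * Y s) l k) := fun l => by ring
    simp only [h1, h2, ← Finset.mul_sum, e']
    ring
  -- The equation holds pointwise only almost everywhere; absolute continuity is what makes a null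
  -- derivative a.e. imply constancy.
  obtain ⟨C, hC⟩ := hac.const_of_ae_hasDerivAt_zero (hderiv.mono fun s hs _ => hs)
  have h0 := hC 0 (by simp)
  rw [hX.apply_zero, hY.apply_zero] at h0
  rw [h0]
  exact hC t (by simp)

end IsTimeEvolutionFrom

theorem IsTimeEvolution.isTimeEvolutionFrom {H U : ℝ → Matrix (Fin N) (Fin N) ℂ}
    (hU : IsTimeEvolution H U) : IsTimeEvolutionFrom H 1 U := hU

namespace IsTimeEvolution

variable {H U : ℝ → Matrix (Fin N) (Fin N) ℂ}

theorem conjTranspose_mul_self (hU : IsTimeEvolution H U)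
    (hH : ∀ j k, LocallyIntegrable (fun t => H t j k)) (hherm : ∀ t, (H t).IsHermitian) (t : ℝ) :
    (U t).conjTranspose * U t = 1 := by
  have hU' := hU.isTimeEvolutionFrom
  simpa using hU'.conjTranspose_mul hU' hH hherm t

/-- Compared with `U` at time `T / 2`, this solution relates `U (-T)` to the propagators at `± T /
2`. -/
theorem shift (hU : IsTimeEvolution H U)
    (hH : ∀ j k, LocallyIntegrable (fun t => H t j k)) {T : ℝ} (hT : Function.Periodic H T) :
    IsTimeEvolutionFrom H (U (-T)) (fun t => U (t - T)) := by
  refine ⟨hU.1.comp (continuous_id.sub continuous_const), fun t j k => ?_⟩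
  change U (t - T) j k = U (-T) j k - Complex.I * ∫ s in (0 : ℝ)..t, (H s * U (s - T)) j k
  have hi (c d : ℝ) : IntervalIntegrable (fun s => (H s * U s) j k) volume c d :=
    ((LocallyIntegrable.matrix_mul_apply hH hU.1 j k).integrableOn_isCompact
      isCompact_uIcc).intervalIntegrable
  have h1 : ∫ s in (0 : ℝ)..t, (H s * U (s - T)) j k
      = ∫ s in (-T)..(t - T), (H s * U s) j k := by
    have := intervalIntegral.integral_comp_sub_right (a := 0) (b := t)
      (fun s => (H s * U s) j k) T
    simpa [hT.sub_eq] using this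
  rw [h1, ← intervalIntegral.integral_interval_sub_left (hi 0 _) (hi 0 _), hU.2 (t - T) j k,
    hU.2 (-T) j k]
  ring

/-- The sign from reversing time cancels the sign in the chiral symmetry. -/
theorem chiral_reflect (hU : IsTimeEvolution H U) {Γ : Matrix (Fin N) (Fin N) ℂ}
    (hH : ∀ j k, LocallyIntegrable (fun t => H t j k))
    (hΓ : Γ * Γ = 1) (hchiral : ∀ t, Γ * H t * Γ = -H (-t)) :
    IsTimeEvolution H (fun t => Γ * U (-t) * Γ) := by
  refine ⟨(continuous_const.mul (hU.1.comp continuous_neg)).mul continuous_const,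
    fun t j k => ?_⟩
  change (Γ * U (-t) * Γ) j k = (1 : Matrix (Fin N) (Fin N) ℂ) j k
    - Complex.I * ∫ s in (0 : ℝ)..t, (H s * (Γ * U (-s) * Γ)) j k
  have e (A B C : Matrix (Fin N) (Fin N) ℂ) :
      (A * B * C) j k = ∑ m, (∑ l, A j l * B l m) * C m k := by
    simp only [Matrix.mul_apply]
  have hi (l m : Fin N) : IntervalIntegrable (fun s => (H s * U s) l m) volume 0 (-t) :=
    ((LocallyIntegrable.matrix_mul_apply hH hU.1 l m).integrableOn_isCompact
      isCompact_uIcc).intervalIntegrable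
  have h1 (s : ℝ) : H s * (Γ * U (-s) * Γ) = -(Γ * (H (-s) * U (-s)) * Γ) := by
    have h : Γ * H (-s) = -(H s * Γ) := by
      have := congrArg (· * Γ) (hchiral (-s))
      simpa [Matrix.mul_assoc, hΓ] using this
    simp only [← Matrix.mul_assoc, h, Matrix.neg_mul, neg_neg]
  have h2 : ∫ s in (0 : ℝ)..t, (H s * (Γ * U (-s) * Γ)) j k
      = ∫ s in (0 : ℝ)..(-t), (Γ * (H s * U s) * Γ) j k := by
    simp only [h1, Matrix.neg_apply, intervalIntegral.integral_neg]
    rw [intervalIntegral.integral_comp_neg (fun s => (Γ * (H s * U s) * Γ) j k), neg_zero,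
      ← intervalIntegral.integral_symm]
  have h3 : ∫ s in (0 : ℝ)..(-t), (Γ * (H s * U s) * Γ) j k
      = ∑ m, (∑ l, Γ j l * ∫ s in (0 : ℝ)..(-t), (H s * U s) l m) * Γ m k := by
    simp only [e]
    rw [intervalIntegral.integral_finsetSum]
    · refine Finset.sum_congr rfl fun m _ => ?_
      rw [intervalIntegral.integral_mul_const, intervalIntegral.integral_finsetSum]
      · simp only [intervalIntegral.integral_const_mul]
      · exact fun l _ => (hi l m).const_mul _
    · exact fun m _ => by
        simpa only [Finset.sum_apply] using
          (IntervalIntegrable.sum Finset.univ fun l _ => (hi l m).const_mul (Γ j l)).mul_const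
            (Γ m k)
  rw [h2, h3]
  have h4 : (1 : Matrix (Fin N) (Fin N) ℂ) j k =
      (Γ * (1 : Matrix (Fin N) (Fin N) ℂ) * Γ) j k := by
    rw [Matrix.mul_one, hΓ]
  rw [h4, e, e]
  simp only [hU.2 (-t)]
  simp only [Finset.mul_sum, Finset.sum_mul, ← Finset.sum_sub_distrib]
  refine Finset.sum_congr rfl fun m _ => Finset.sum_congr rfl fun l _ => ?_
  ring

/-- The Floquet operator in terms of the half-period propagator. -/
theorem floquet_eq (hU : IsTimeEvolution H U) {Γ : Matrix (Fin N) (Fin N) ℂ} {T : ℝ}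
    (hH : ∀ j k, LocallyIntegrable (fun t => H t j k)) (hherm : ∀ t, (H t).IsHermitian)
    (hT : Function.Periodic H T) (hΓ : Γ * Γ = 1) (hchiral : ∀ t, Γ * H t * Γ = -H (-t)) :
    U T = Γ * (U (T / 2)).conjTranspose * Γ * U (T / 2) := by
  -- Uniqueness: two solutions starting at `1` have `(U t)ᴴ * Y t = 1`, and `U t` is unitary.
  have hrefl (t : ℝ) : U t = Γ * U (-t) * Γ := by
    have h := hU.isTimeEvolutionFrom.conjTranspose_mul
      (hU.chiral_reflect hH hΓ hchiral).isTimeEvolutionFrom hH hherm t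
    simp only [Matrix.conjTranspose_one, Matrix.one_mul] at h
    have h' := mul_eq_one_comm.mp (hU.conjTranspose_mul_self hH hherm t)
    calc U t = U t * ((U t).conjTranspose * (Γ * U (-t) * Γ)) := by rw [h, Matrix.mul_one]
      _ = _ := by rw [← Matrix.mul_assoc, h', Matrix.one_mul]
  have h := hU.isTimeEvolutionFrom.conjTranspose_mul (hU.shift hH hT) hH hherm (T / 2)
  simp only [Matrix.conjTranspose_one, Matrix.one_mul] at h
  have e : T / 2 - T = -(T / 2) := by ring
  rw [hrefl T, ← h, e, hrefl (-(T / 2)), neg_neg]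
  simp only [Matrix.mul_assoc, hΓ, Matrix.mul_one]

end IsTimeEvolution

end Evolution

end TimeEvolution

/-! ### Eigenvectors of a chiral pair and their pairing under the involution. -/

section ChiralPair

open Module LinearMap
open scoped InnerProductSpace

variable {V : Type*} [NormedAddCommGroup V] [InnerProductSpace ℂ V]

/-- An isometric involution `A` and an isometry `U` with `A U A = U⁻¹` such that
`A` and `A U` are traceless. -/
structure IsChiralPair (A U : V →ₗ[ℂ] V) : Prop where
  inner_A : ∀ x y, ⟪A x, A y⟫_ℂ = ⟪x, y⟫_ℂ
  inner_U : ∀ x y, ⟪U x, U y⟫_ℂ = ⟪x, y⟫_ℂ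
  A_A : ∀ x, A (A x) = x
  A_U_A_U : ∀ x, A (U (A (U x))) = x
  trace_A : trace ℂ V A = 0
  trace_A_U : trace ℂ V (A ∘ₗ U) = 0

namespace IsChiralPair

variable {A U : V →ₗ[ℂ] V}

theorem inner_A_left (h : IsChiralPair A U) (x y : V) : ⟪A x, y⟫_ℂ = ⟪x, A y⟫_ℂ := by
  rw [← h.inner_A x (A y), h.A_A]

theorem U_A_U (h : IsChiralPair A U) (x : V) : U (A (U x)) = A x := by
  rw [← h.A_A (U (A (U x))), h.A_U_A_U]

theorem U_A_U_A (h : IsChiralPair A U) (x : V) : U (A (U (A x))) = x := by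
  rw [h.U_A_U, h.A_A]

theorem inner_U_left (h : IsChiralPair A U) (x y : V) : ⟪U x, y⟫_ℂ = ⟪x, A (U (A y))⟫_ℂ := by
  rw [← h.inner_U x, h.U_A_U_A]

theorem conj_mul_of_eigen (h : IsChiralPair A U) {v : V} (hv : v ≠ 0) {l : ℂ}
    (hl : U v = l • v) : (starRingEnd ℂ) l * l = 1 := by
  have h1 := h.inner_U v v
  rw [hl, inner_smul_left, inner_smul_right, ← mul_assoc] at h1
  exact mul_right_cancel₀ (inner_self_ne_zero.mpr hv) (h1.trans (one_mul _).symm)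

theorem eigen_A (h : IsChiralPair A U) {v : V} (hv : v ≠ 0) {l : ℂ} (hl : U v = l • v) :
    U (A v) = (starRingEnd ℂ) l • A v := by
  have h1 := h.U_A_U v
  rw [hl, map_smul, map_smul] at h1
  calc U (A v) = ((starRingEnd ℂ) l * l) • U (A v) := by
        rw [h.conj_mul_of_eigen hv hl, one_smul]
    _ = _ := by rw [mul_smul, h1]

variable [FiniteDimensional ℂ V]

/-- Eigenvectors for `±1` are orthogonal to the range of `U² - 1`, so an eigenvector inside this
invariant subspace has `l² ≠ 1`. Invariance of the inner product then gives `⟪v, A v⟫ = (conj l)²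
⟪v, A v⟫`, which must vanish. -/
theorem exists_eigenvector_of_sq_ne_one (h : IsChiralPair A U) (hU : ∃ x, U (U x) ≠ x) :
    ∃ v ≠ 0, ⟪v, A v⟫_ℂ = 0 ∧ ∃ l : ℂ, U v = l • v := by
  set R : Submodule ℂ V := range (U ∘ₗ U - 1) with hR
  have hinv : ∀ x ∈ R, U x ∈ R := by
    rintro _ ⟨y, rfl⟩
    exact ⟨U y, by simp⟩
  obtain ⟨x, hx⟩ := hU
  have hne : Nontrivial R := by
    refine (Submodule.nontrivial_iff_ne_bot).mpr fun hbot => hx ?_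
    have h1 : U (U x) - x ∈ R := ⟨x, by simp⟩
    rw [hbot, Submodule.mem_bot] at h1
    exact sub_eq_zero.mp h1
  obtain ⟨l, hl⟩ := Module.End.exists_eigenvalue (U.restrict hinv)
  obtain ⟨⟨v, hvR⟩, hv⟩ := hl.exists_hasEigenvector
  have hv0 : v ≠ 0 := fun h0 => hv.2 (Subtype.ext h0)
  have hUv : U v = l • v := congrArg Subtype.val hv.apply_eq_smul
  refine ⟨v, hv0, ?_, l, hUv⟩
  have hll := h.conj_mul_of_eigen hv0 hUv
  have hl2 : l * l ≠ 1 := by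
    intro hl2
    have hlc : (starRingEnd ℂ) l = l := by
      calc (starRingEnd ℂ) l = (starRingEnd ℂ) l * (l * l) := by rw [hl2, mul_one]
        _ = l := by rw [← mul_assoc, hll, one_mul]
    obtain ⟨y, hy⟩ := hvR
    have hUU : A (U (A (A (U (A v))))) = v := by
      rw [h.A_A, h.eigen_A hv0 hUv, map_smul, h.eigen_A hv0 hUv, hlc, smul_smul, hl2, one_smul,
        h.A_A]
    apply hv0
    rw [← inner_self_eq_zero (𝕜 := ℂ)]
    nth_rewrite 1 [← hy]
    simp only [LinearMap.sub_apply, LinearMap.comp_apply, Module.End.one_apply, inner_sub_left]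
    rw [h.inner_U_left, h.inner_U_left, hUU, sub_self]
  have h1 := h.inner_U v (A v)
  rw [hUv, h.eigen_A hv0 hUv, inner_smul_left, inner_smul_right, ← mul_assoc] at h1
  have hcc : (starRingEnd ℂ) l * (starRingEnd ℂ) l ≠ 1 := fun hc => hl2 (by
    have := congrArg (starRingEnd ℂ) hc
    simpa using this)
  by_contra hne0
  exact hcc (mul_right_cancel₀ hne0 (h1.trans (one_mul _).symm))

/-- Here `A` and `U` commute, and the joint eigenspace for `(ε, σ)` has dimension `tr ((1 + ε A)(1 +
σ U)) / 4 = tr (1 + σ U) / 4`, independent of `ε`. Some `σ` thus occurs with both signs of `A`. -/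
theorem exists_eigenvector_of_sq_eq_one [Nontrivial V] (h : IsChiralPair A U)
    (hU : ∀ x, U (U x) = x) :
    ∃ v ≠ 0, ⟪v, A v⟫_ℂ = 0 ∧ ∃ l : ℂ, U v = l • v := by
  have hcomm (x : V) : U (A x) = A (U x) := by
    rw [← h.U_A_U (U x), hU]
  -- The traces of `1 + U` and `1 - U` add up to twice the dimension.
  obtain ⟨σ, hσ, htr⟩ : ∃ σ : ℂ, σ * σ = 1 ∧ trace ℂ V (1 + σ • U) ≠ 0 := by
    by_contra! hcon
    have h1 := hcon 1 (by simp)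
    have h2 := hcon (-1) (by simp)
    rw [map_add, map_smul, trace_one, smul_eq_mul] at h1 h2
    have h3 : (finrank ℂ V : ℂ) = 0 := by linear_combination (h1 + h2) / 2
    exact Module.finrank_pos.ne' (Nat.cast_eq_zero.mp h3)
  have hP : ∀ ε : ℂ, ε * ε = 1 →
      ∃ p ≠ 0, A p = ε • p ∧ U p = σ • p := by
    intro ε hε
    -- Four times the joint spectral projection; any nonzero value of it is a joint eigenvector.
    have hne : (1 + ε • A + (ε * σ) • (A ∘ₗ U) + σ • U : V →ₗ[ℂ] V) ≠ 0 := by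
      intro h0
      apply htr
      have := congrArg (trace ℂ V) h0
      simpa [h.trace_A, h.trace_A_U] using this
    obtain ⟨x, hx⟩ : ∃ x, (1 + ε • A + (ε * σ) • (A ∘ₗ U) + σ • U : V →ₗ[ℂ] V) x ≠ 0 := by
      by_contra! hcon
      exact hne (LinearMap.ext hcon)
    refine ⟨_, hx, ?_, ?_⟩
    · simp only [LinearMap.add_apply, LinearMap.smul_apply, LinearMap.comp_apply,
        Module.End.one_apply, map_add, map_smul, h.A_A, smul_add, smul_smul, hε, ← mul_assoc,
        one_mul, one_smul]
      abel
    · simp only [LinearMap.add_apply, LinearMap.smul_apply, LinearMap.comp_apply,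
        Module.End.one_apply, map_add, map_smul, hcomm, hU, smul_add, smul_smul, hσ, one_smul,
        mul_left_comm σ ε σ, mul_one, mul_comm σ ε]
      abel
  obtain ⟨p, hp0, hAp, hUp⟩ := hP 1 (by simp)
  obtain ⟨q, hq0, hAq, hUq⟩ := hP (-1) (by simp)
  rw [one_smul] at hAp
  rw [neg_one_smul] at hAq
  have hpq : ⟪p, q⟫_ℂ = 0 := by
    have h1 := h.inner_A p q
    rw [hAp, hAq, inner_neg_right] at h1
    linear_combination (-1 / 2 : ℂ) * h1
  have hqp : ⟪q, p⟫_ℂ = 0 := inner_eq_zero_symm.mp hpq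
  -- The weights give both components equal norm, so their contributions `± ‖p‖² ‖q‖²` to `⟪v, A v⟫`
  -- cancel.
  refine ⟨(‖q‖ : ℂ) • p + (‖p‖ : ℂ) • q, ?_, ?_, σ, ?_⟩
  · intro h0
    have h1 := congrArg (fun z => ⟪p, z⟫_ℂ) h0
    simp only [inner_add_right, inner_smul_right, hpq, inner_zero_right, mul_zero, add_zero,
      mul_eq_zero, inner_self_eq_zero, hp0, or_false, Complex.ofReal_eq_zero, norm_eq_zero] at h1
    exact hq0 h1
  · simp only [map_add, map_smul, hAp, hAq, inner_add_left, inner_add_right, inner_smul_left,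
      inner_smul_right, inner_neg_right, hpq, hqp, Complex.conj_ofReal,
      inner_self_eq_norm_sq_to_K, smul_neg]
    simp only [Complex.coe_algebraMap]
    ring
  · rw [map_add, map_smul, map_smul, hUp, hUq, smul_add, smul_comm σ, smul_comm σ]

theorem exists_unit_eigenvector [Nontrivial V] (h : IsChiralPair A U) :
    ∃ v, ‖v‖ = 1 ∧ ⟪v, A v⟫_ℂ = 0 ∧ ∃ l : ℂ, U v = l • v := by
  obtain ⟨v, hv0, hvA, l, hl⟩ : ∃ v ≠ 0, ⟪v, A v⟫_ℂ = 0 ∧ ∃ l : ℂ, U v = l • v := by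
    by_cases hU : ∀ x, U (U x) = x
    · exact h.exists_eigenvector_of_sq_eq_one hU
    · exact h.exists_eigenvector_of_sq_ne_one (not_forall.mp hU)
  refine ⟨((‖v‖ : ℂ)⁻¹) • v, norm_smul_inv_norm hv0, ?_, l, ?_⟩
  · rw [map_smul, inner_smul_left, inner_smul_right, hvA, mul_zero, mul_zero]
  · rw [map_smul, hl, smul_comm]

end IsChiralPair

theorem Orthonormal.sumElim {ι κ : Type*} {f : ι → V} {g : κ → V} (hf : Orthonormal ℂ f)
    (hg : Orthonormal ℂ g) (hfg : ∀ i j, ⟪f i, g j⟫_ℂ = 0) : Orthonormal ℂ (Sum.elim f g) := by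
  refine ⟨by rintro (i | j) <;> simp [hf.1, hg.1], ?_⟩
  rintro (i | i) (j | j) hij
  · exact hf.2 fun h => hij (by rw [h])
  · exact hfg i j
  · exact inner_eq_zero_symm.mp (hfg j i)
  · exact hg.2 fun h => hij (by rw [h])

/-- The orthogonal complement of the span of `v` and `w`. -/
noncomputable def pairComplement (v w : V) : Submodule ℂ V :=
  (Submodule.span ℂ (Set.range ![v, w]))ᗮ

theorem mem_pairComplement {v w x : V} :
    x ∈ pairComplement v w ↔ ⟪v, x⟫_ℂ = 0 ∧ ⟪w, x⟫_ℂ = 0 := by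
  rw [pairComplement, Submodule.mem_orthogonal]
  constructor
  · exact fun hx => ⟨hx v (Submodule.subset_span ⟨0, rfl⟩), hx w (Submodule.subset_span ⟨1, rfl⟩)⟩
  · rintro ⟨h1, h2⟩ u hu
    induction hu using Submodule.span_induction with
    | mem y hy =>
      obtain ⟨i, rfl⟩ := hy
      fin_cases i
      · exact h1
      · exact h2
    | zero => exact inner_zero_left _
    | add y z _ _ hy hz => rw [inner_add_left, hy, hz, add_zero]
    | smul a y _ hy => rw [inner_smul_left, hy, mul_zero]

theorem orthonormal_pair {v w : V} (hv : ‖v‖ = 1) (hw : ‖w‖ = 1) (hvw : ⟪v, w⟫_ℂ = 0) :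
    Orthonormal ℂ ![v, w] := by
  refine ⟨fun i => by fin_cases i <;> simp [hv, hw], fun i j hij => ?_⟩
  fin_cases i <;> fin_cases j
  · exact absurd rfl hij
  · exact hvw
  · exact inner_eq_zero_symm.mp hvw
  · exact absurd rfl hij

variable [FiniteDimensional ℂ V] in
theorem finrank_pairComplement {v w : V} (hv : ‖v‖ = 1) (hw : ‖w‖ = 1) (hvw : ⟪v, w⟫_ℂ = 0) :
    2 + finrank ℂ (pairComplement v w) = finrank ℂ V := by
  rw [← Submodule.finrank_add_finrank_orthogonal (Submodule.span ℂ (Set.range ![v, w])),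
    finrank_span_eq_card (orthonormal_pair hv hw hvw).linearIndependent, Fintype.card_fin]
  rfl

variable [FiniteDimensional ℂ V] in
theorem trace_eq_add_trace_restrict {v w : V} (hv : ‖v‖ = 1) (hw : ‖w‖ = 1)
    (hvw : ⟪v, w⟫_ℂ = 0) {T : V →ₗ[ℂ] V}
    (hT : ∀ x ∈ pairComplement v w, T x ∈ pairComplement v w) :
    trace ℂ V T = ⟪v, T v⟫_ℂ + ⟪w, T w⟫_ℂ + trace ℂ (pairComplement v w) (T.restrict hT) := by
  let c := stdOrthonormalBasis ℂ (pairComplement v w)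
  have ho : Orthonormal ℂ (Sum.elim ![v, w] fun i => (c i : V)) := by
    refine (orthonormal_pair hv hw hvw).sumElim
      (c.orthonormal.comp_linearIsometry (pairComplement v w).subtypeₗᵢ) fun i j => ?_
    have hc := mem_pairComplement.mp (c j).2
    fin_cases i
    · exact hc.1
    · exact hc.2
  have hspan := ho.linearIndependent.span_eq_top_of_card_eq_finrank' (by
    rw [Fintype.card_sum, Fintype.card_fin, Fintype.card_fin, finrank_pairComplement hv hw hvw])
  rw [LinearMap.trace_eq_sum_inner T (OrthonormalBasis.mk ho hspan.ge),
    LinearMap.trace_eq_sum_inner _ c]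
  simp [Fin.sum_univ_two]

namespace IsChiralPair

variable {A U : V →ₗ[ℂ] V}

theorem norm_A (h : IsChiralPair A U) (x : V) : ‖A x‖ = ‖x‖ := by
  rw [norm_eq_sqrt_re_inner (𝕜 := ℂ), norm_eq_sqrt_re_inner (𝕜 := ℂ), h.inner_A]

theorem mapsTo_A (h : IsChiralPair A U) (v : V) :
    ∀ x ∈ pairComplement v (A v), A x ∈ pairComplement v (A v) := by
  intro x hx
  rw [mem_pairComplement] at hx ⊢
  rwa [h.inner_A, ← h.inner_A_left, and_comm]

theorem mapsTo_U (h : IsChiralPair A U) {v : V} {l : ℂ} (hv : v ≠ 0) (hl : U v = l • v) :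
    ∀ x ∈ pairComplement v (A v), U x ∈ pairComplement v (A v) := by
  intro x hx
  rw [mem_pairComplement] at hx ⊢
  have hne := h.conj_mul_of_eigen hv hl
  have h1 := h.inner_U v x
  have h2 := h.inner_U (A v) x
  rw [hl, inner_smul_left, hx.1] at h1
  rw [h.eigen_A hv hl, inner_smul_left, hx.2, Complex.conj_conj] at h2
  exact ⟨(mul_eq_zero.mp h1).resolve_left (left_ne_zero_of_mul_eq_one hne),
    (mul_eq_zero.mp h2).resolve_left (right_ne_zero_of_mul_eq_one hne)⟩

variable [FiniteDimensional ℂ V] in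
-- On the plane of `v` and `A v`, the diagonal entries of `A` and `A U` are multiples of `⟪v, A v⟫`
-- or its conjugate, hence zero. Both traces therefore live on the complement.
theorem restrict (h : IsChiralPair A U) {v : V} {l : ℂ} (hv : ‖v‖ = 1) (hvA : ⟪v, A v⟫_ℂ = 0)
    (hl : U v = l • v) (hA : ∀ x ∈ pairComplement v (A v), A x ∈ pairComplement v (A v))
    (hU : ∀ x ∈ pairComplement v (A v), U x ∈ pairComplement v (A v)) :
    IsChiralPair (A.restrict hA) (U.restrict hU) where
  inner_A x y := h.inner_A x y
  inner_U x y := h.inner_U x y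
  A_A x := Subtype.ext (h.A_A x)
  A_U_A_U x := Subtype.ext (h.A_U_A_U x)
  trace_A := by
    have h1 := trace_eq_add_trace_restrict hv ((h.norm_A v).trans hv) hvA hA
    rw [h.trace_A, h.A_A, hvA, h.inner_A_left, hvA] at h1
    simpa using h1.symm
  trace_A_U := by
    have hv0 : v ≠ 0 := norm_ne_zero_iff.mp (by rw [hv]; exact one_ne_zero)
    have h1 := trace_eq_add_trace_restrict (T := A ∘ₗ U) hv ((h.norm_A v).trans hv) hvA
      fun x hx => hA _ (hU x hx)
    have e : A.restrict hA ∘ₗ U.restrict hU = (A ∘ₗ U).restrict fun x hx => hA _ (hU x hx) := rfl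
    rw [h.trace_A_U, LinearMap.comp_apply, LinearMap.comp_apply, hl, h.inner_A,
      h.eigen_A hv0 hl, map_smul, inner_smul_right, inner_smul_right, hvA] at h1
    rw [e]
    simpa using h1.symm

end IsChiralPair

theorem IsChiralPair.exists_eigenbasis (k : ℕ) :
    ∀ {V : Type*} [NormedAddCommGroup V] [InnerProductSpace ℂ V] [FiniteDimensional ℂ V]
      {A U : V →ₗ[ℂ] V}, IsChiralPair A U → finrank ℂ V = 2 * k →
      ∃ (v : Fin k → V) (l : Fin k → ℂ), Orthonormal ℂ v ∧ (∀ i j, ⟪v i, A (v j)⟫_ℂ = 0) ∧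
        ∀ i, U (v i) = l i • v i := by
  induction k with
  | zero =>
    intro V _ _ _ A U _ _
    exact ⟨Fin.elim0, Fin.elim0, ⟨fun i => i.elim0, fun i => i.elim0⟩, fun i => i.elim0,
      fun i => i.elim0⟩
  | succ k ih =>
    intro V _ _ _ A U h hk
    have : Nontrivial V := Module.nontrivial_of_finrank_pos (R := ℂ) (by omega)
    obtain ⟨v, hv, hvA, l, hl⟩ := h.exists_unit_eigenvector
    have hv0 : v ≠ 0 := norm_ne_zero_iff.mp (by rw [hv]; exact one_ne_zero)
    have hA := h.mapsTo_A v
    have hU := h.mapsTo_U hv0 hl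
    have hrank := finrank_pairComplement hv ((h.norm_A v).trans hv) hvA
    obtain ⟨w, m, hw, hwA, hm⟩ := ih (h.restrict hv hvA hl hA hU) (by omega)
    have hperp (i) := mem_pairComplement.mp (w i).2
    refine ⟨Fin.cons v fun i => (w i : V), Fin.cons l m, ⟨?_, ?_⟩, ?_, ?_⟩
    · exact Fin.cases hv fun i => hw.1 i
    · intro i j
      refine Fin.cases ?_ (fun i => ?_) i <;> refine Fin.cases ?_ (fun j => ?_) j
      · exact fun h => absurd rfl h
      · exact fun _ => (hperp j).1
      · exact fun _ => inner_eq_zero_symm.mp (hperp i).1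
      · exact fun hij => hw.2 fun h => hij (congrArg Fin.succ h)
    · intro i j
      refine Fin.cases ?_ (fun i => ?_) i <;> refine Fin.cases ?_ (fun j => ?_) j
      · exact hvA
      · exact (h.inner_A_left v (w j)).symm.trans (hperp j).2
      · exact inner_eq_zero_symm.mp (hperp i).2
      · exact hwA i j
    · exact Fin.cases hl fun i => congrArg Subtype.val (hm i)

end ChiralPair

/-! ### Balanced involutions are traceless. -/

section Involution

open Module LinearMap

variable {V : Type*} [AddCommGroup V] [Module ℂ V]

/-- The trace of a projection is its rank, which turns the balance of the eigenspaces into a trace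
identity. -/
theorem isProj_eigenspace_of_involution {f : V →ₗ[ℂ] V} (hf : ∀ x, f (f x) = x) {ε : ℂ}
    (hε : ε * ε = 1) :
    LinearMap.IsProj (Module.End.eigenspace f ε) ((2⁻¹ : ℂ) • (1 + ε • f)) where
  map_mem x := by
    rw [Module.End.mem_eigenspace_iff]
    simp only [LinearMap.smul_apply, LinearMap.add_apply, Module.End.one_apply, map_smul, map_add,
      hf]
    rw [smul_comm ε, smul_add ε, smul_smul ε ε, hε, one_smul, add_comm]
  map_id x hx := by
    rw [Module.End.mem_eigenspace_iff] at hx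
    simp only [LinearMap.smul_apply, LinearMap.add_apply, Module.End.one_apply]
    rw [hx, smul_smul, hε, one_smul, ← two_smul ℂ x, smul_smul, inv_mul_cancel₀ two_ne_zero,
      one_smul]

variable [FiniteDimensional ℂ V] in
theorem trace_eq_zero_of_balanced_involution {f : V →ₗ[ℂ] V} (hf : ∀ x, f (f x) = x)
    (hbal : finrank ℂ (Module.End.eigenspace f (1 : ℂ)) =
      finrank ℂ (Module.End.eigenspace f (-1 : ℂ))) :
    trace ℂ V f = 0 ∧ finrank ℂ V = 2 * finrank ℂ (Module.End.eigenspace f (1 : ℂ)) := by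
  have h1 := (isProj_eigenspace_of_involution hf (ε := 1) (by simp)).trace
  have h2 := (isProj_eigenspace_of_involution hf (ε := -1) (by simp)).trace
  rw [← hbal] at h2
  rw [map_smul, map_add, map_smul, trace_one, smul_eq_mul, smul_eq_mul] at h1 h2
  refine ⟨by linear_combination h1 - h2, ?_⟩
  have h3 : (finrank ℂ V : ℂ) =
      ((2 * finrank ℂ (Module.End.eigenspace f (1 : ℂ)) : ℕ) : ℂ) := by
    push_cast
    linear_combination h1 + h2
  exact_mod_cast h3

end Involution

/-! ### Matrices with a prescribed orthonormal eigenbasis. -/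

section Spectral

variable {n : Type*} [Fintype n] [DecidableEq n]

/-- The matrix with eigenvectors `b j` and eigenvalues `d j`. -/
noncomputable def spectralMatrix (b : OrthonormalBasis n ℂ (EuclideanSpace ℂ n)) (d : n → ℂ) :
    Matrix n n ℂ :=
  Matrix.of (fun i j => b j i) * Matrix.diagonal d * (Matrix.of fun i j => b j i).conjTranspose

variable (b : OrthonormalBasis n ℂ (EuclideanSpace ℂ n)) (d : n → ℂ)

theorem OrthonormalBasis.conjTranspose_mul_self :
    (Matrix.of fun i j => b j i).conjTranspose * (Matrix.of fun i j => b j i) = 1 := by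
  ext i j
  have h := (orthonormal_iff_ite.mp b.orthonormal) i j
  rw [PiLp.inner_apply] at h
  simp only [Matrix.mul_apply, Matrix.conjTranspose_apply, Matrix.of_apply, Matrix.one_apply]
  rw [← h]
  exact Finset.sum_congr rfl fun l _ => mul_comm _ _

theorem OrthonormalBasis.toEuclideanLin_spectralMatrix (j : n) :
    Matrix.toEuclideanLin (spectralMatrix b d) (b j) = d j • b j := by
  have h : spectralMatrix b d * Matrix.of (fun i j => b j i)
      = Matrix.of (fun i j => b j i) * Matrix.diagonal d := by
    rw [spectralMatrix, Matrix.mul_assoc, b.conjTranspose_mul_self, Matrix.mul_one]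
  ext i
  have h1 := congrFun (congrFun h i) j
  rw [Matrix.mul_diagonal, Matrix.mul_apply] at h1
  simpa [Matrix.toLpLin_apply, Matrix.mulVec, dotProduct, mul_comm] using h1

theorem conjTranspose_spectralMatrix :
    (spectralMatrix b d).conjTranspose = spectralMatrix b (star d) := by
  simp [spectralMatrix, Matrix.mul_assoc]

theorem smul_spectralMatrix (c : ℂ) : c • spectralMatrix b d = spectralMatrix b (c • d) := by
  simp [spectralMatrix, Matrix.diagonal_smul]

theorem exp_spectralMatrix :
    NormedSpace.exp (spectralMatrix b d) = spectralMatrix b fun j => Complex.exp (d j) := by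
  have h := b.conjTranspose_mul_self
  have hu : IsUnit (Matrix.of fun i j => b j i) := IsUnit.of_mul_eq_one_right _ h
  have hinv : (Matrix.of fun i j => b j i)⁻¹ = (Matrix.of fun i j => b j i).conjTranspose :=
    Matrix.inv_eq_left_inv h
  rw [spectralMatrix, spectralMatrix, ← hinv, Matrix.exp_conj _ _ hu, Matrix.exp_diagonal]
  congr 3
  ext j
  rw [Pi.coe_exp, Complex.exp_eq_exp_ℂ]

theorem OrthonormalBasis.matrix_ext {A B : Matrix n n ℂ}
    (h : ∀ j, Matrix.toEuclideanLin A (b j) = Matrix.toEuclideanLin B (b j)) : A = B :=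
  Matrix.toEuclideanLin.injective (b.toBasis.ext fun j => by simpa using h j)

end Spectral

/-! ### From the paired eigenbasis to the chiral logarithm. -/

section Floquet

open scoped InnerProductSpace

variable {n : Type*} [Fintype n] [DecidableEq n]

theorem Matrix.toEuclideanLin_mul_apply (A B : Matrix n n ℂ) (x : EuclideanSpace ℂ n) :
    Matrix.toEuclideanLin (A * B) x = Matrix.toEuclideanLin A (Matrix.toEuclideanLin B x) := by
  rw [Matrix.toEuclideanLin, Matrix.toLpLin_mul_same, LinearMap.comp_apply]

theorem Matrix.inner_toEuclideanLin_of_conjTranspose_mul_self {A : Matrix n n ℂ}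
    (hA : A.conjTranspose * A = 1) (x y : EuclideanSpace ℂ n) :
    ⟪Matrix.toEuclideanLin A x, Matrix.toEuclideanLin A y⟫_ℂ = ⟪x, y⟫_ℂ := by
  rw [← LinearMap.adjoint_inner_right, ← Matrix.toEuclideanLin_conjTranspose_eq_adjoint,
    ← Matrix.toEuclideanLin_mul_apply, hA, Matrix.toEuclideanLin, Matrix.toLpLin_one,
    LinearMap.id_apply]

theorem Matrix.trace_toEuclideanLin (A : Matrix n n ℂ) :
    LinearMap.trace ℂ _ (Matrix.toEuclideanLin A) = A.trace := by
  rw [LinearMap.trace_eq_sum_inner _ (EuclideanSpace.basisFun n ℂ)]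
  simp [Matrix.trace, Matrix.toLpLin_apply, EuclideanSpace.inner_single_left]

theorem isChiralPair_toEuclideanLin {Γ U : Matrix n n ℂ}
    (hΓ : Γ.conjTranspose * Γ = 1) (hΓ_sq : Γ * Γ = 1) (hΓ_tr : Γ.trace = 0)
    (hU : U.conjTranspose * U = 1) (hΓU : Γ * U * (Γ * U) = 1) (hΓU_tr : (Γ * U).trace = 0) :
    IsChiralPair (Matrix.toEuclideanLin Γ) (Matrix.toEuclideanLin U) where
  inner_A := Matrix.inner_toEuclideanLin_of_conjTranspose_mul_self hΓ
  inner_U := Matrix.inner_toEuclideanLin_of_conjTranspose_mul_self hU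
  A_A x := by
    rw [← Matrix.toEuclideanLin_mul_apply, hΓ_sq, Matrix.toEuclideanLin, Matrix.toLpLin_one,
      LinearMap.id_apply]
  A_U_A_U x := by
    simp only [← Matrix.toEuclideanLin_mul_apply]
    rw [← Matrix.mul_assoc, hΓU, Matrix.toEuclideanLin, Matrix.toLpLin_one, LinearMap.id_apply]
  trace_A := by rw [Matrix.trace_toEuclideanLin, hΓ_tr]
  trace_A_U := by
    rw [Matrix.toEuclideanLin, ← Matrix.toLpLin_mul_same]
    exact (Matrix.trace_toEuclideanLin _).trans hΓU_tr

/-- A chiral pair of matrices has an orthonormal basis of eigenvectors of `U`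
that is permuted by `Γ`. -/
theorem IsChiralPair.exists_orthonormalBasis {Γ U : Matrix n n ℂ} {k : ℕ}
    (h : IsChiralPair (Matrix.toEuclideanLin Γ) (Matrix.toEuclideanLin U))
    (hk : Fintype.card n = 2 * k) :
    ∃ (b : OrthonormalBasis (Fin k ⊕ Fin k) ℂ (EuclideanSpace ℂ n)) (l : Fin k → ℂ),
      (∀ i, ‖l i‖ = 1) ∧ (∀ i, Matrix.toEuclideanLin Γ (b i) = b i.swap) ∧
      ∀ i, Matrix.toEuclideanLin U (b i) = (Sum.elim l (star l) i) • b i := by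
  have hfin : Module.finrank ℂ (EuclideanSpace ℂ n) = 2 * k := by
    rw [finrank_euclideanSpace, hk]
  obtain ⟨v, l, hv, hvA, hl⟩ := h.exists_eigenbasis k hfin
  have hAv : Orthonormal ℂ fun i => Matrix.toEuclideanLin Γ (v i) :=
    ⟨fun i => (h.norm_A _).trans (hv.1 i), fun i j hij => (h.inner_A _ _).trans (hv.2 hij)⟩
  have ho := hv.sumElim hAv hvA
  have hspan := ho.linearIndependent.span_eq_top_of_card_eq_finrank' (by
    rw [Fintype.card_sum, Fintype.card_fin, hfin, two_mul])
  have hv0 (i) : v i ≠ 0 := hv.ne_zero i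
  refine ⟨OrthonormalBasis.mk ho hspan.ge, l, fun i => ?_, ?_, ?_⟩
  · have h1 := h.conj_mul_of_eigen (hv0 i) (hl i)
    rw [Complex.conj_mul'] at h1
    have h2 : ‖l i‖ ^ 2 = 1 := by exact_mod_cast h1
    exact (pow_eq_one_iff_of_nonneg (norm_nonneg _) two_ne_zero).mp h2
  · rintro (i | i)
    · simp
    · simpa using h.A_A (v i)
  · rintro (i | i)
    · simpa using hl i
    · simpa using h.eigen_A (hv0 i) (hl i)

/-- The self-adjoint chiral logarithm of a unitary matrix. -/
theorem IsChiralPair.exists_log {N k : ℕ} (hN : N = 2 * k) {Γ U : Matrix (Fin N) (Fin N) ℂ}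
    (h : IsChiralPair (Matrix.toEuclideanLin Γ) (Matrix.toEuclideanLin U)) :
    ∃ H_F : Matrix (Fin N) (Fin N) ℂ,
      H_F.IsHermitian ∧
      Γ * H_F = -(H_F * Γ) ∧
      NormedSpace.exp (-Complex.I • H_F) = U ∧
      ∃ (b : OrthonormalBasis (Fin N) ℂ (EuclideanSpace ℂ (Fin N)))
        (lam : Fin N → ℂ) (μ : Fin N → ℝ),
        (∀ j, ‖lam j‖ = 1 ∧
          Matrix.toEuclideanLin U (b j) = lam j • b j ∧
          Matrix.toEuclideanLin H_F (b j) = (μ j : ℂ) • b j ∧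
          lam j = Complex.exp (-Complex.I * (μ j : ℂ))) ∧
        ∀ (j : ℕ) (hj : j < N / 2),
          Matrix.toEuclideanLin Γ (b ⟨j, by omega⟩) = b ⟨N / 2 + j, by omega⟩ ∧
          (starRingEnd ℂ) (lam ⟨j, by omega⟩) = lam ⟨N / 2 + j, by omega⟩ ∧
          μ ⟨N / 2 + j, by omega⟩ = -μ ⟨j, by omega⟩ := by
  obtain ⟨c, l, hl, hcΓ, hcU⟩ := h.exists_orthonormalBasis (k := k) (by rw [Fintype.card_fin, hN])
  let e : Fin k ⊕ Fin k ≃ Fin N := finSumFinEquiv.trans (finCongr (by omega))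
  let b := c.reindex e
  -- The phase is chosen on the first half and negated on its `Γ`-images, rather than taken as
  -- `-arg` of each eigenvalue: at `-1` the latter would give `-π` twice.
  let θ : Fin k ⊕ Fin k → ℝ := Sum.elim (fun i => -(l i).arg) fun i => (l i).arg
  let μ : Fin N → ℝ := fun j => θ (e.symm j)
  let lam : Fin N → ℂ := fun j => Sum.elim l (star l) (e.symm j)
  have hθ_swap (i) : θ i.swap = -θ i := by rcases i with i | i <;> simp [θ]
  have hexp (i : Fin k) : Complex.exp ((l i).arg * Complex.I) = l i := by
    have := Complex.norm_mul_exp_arg_mul_I (l i)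
    rwa [hl i, Complex.ofReal_one, one_mul] at this
  have hθ (i) : Sum.elim l (star l) i = Complex.exp (-Complex.I * (θ i : ℂ)) := by
    rcases i with i | i
    · simp only [θ, Sum.elim_inl]
      conv_lhs => rw [← hexp i]
      congr 1
      push_cast
      ring
    · simp only [θ, Sum.elim_inr, Pi.star_apply]
      conv_lhs => rw [← hexp i]
      rw [Complex.star_def, ← Complex.exp_conj, map_mul, Complex.conj_ofReal, Complex.conj_I]
      congr 1
      ring
  have hbU (j) : Matrix.toEuclideanLin U (b j) = lam j • b j := by
    simp only [b, lam, OrthonormalBasis.reindex_apply, hcU]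
  have hbH := b.toEuclideanLin_spectralMatrix fun j => (μ j : ℂ)
  have hcH (i) : Matrix.toEuclideanLin (spectralMatrix b fun j => (μ j : ℂ)) (c i)
      = (θ i : ℂ) • c i := by
    simpa [b, μ] using hbH (e i)
  refine ⟨spectralMatrix b fun j => (μ j : ℂ), ?_, ?_, ?_, b, lam, μ,
    fun j => ⟨?_, hbU j, hbH j, hθ _⟩, fun j hj => ?_⟩
  · rw [Matrix.IsHermitian, conjTranspose_spectralMatrix]
    congr 1
    ext j
    simp
  · refine b.matrix_ext fun j => ?_
    rw [map_neg, LinearMap.neg_apply, Matrix.toEuclideanLin_mul_apply,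
      Matrix.toEuclideanLin_mul_apply, hbH, map_smul]
    simp only [b, μ, OrthonormalBasis.reindex_apply, hcΓ]
    rw [hcH, hθ_swap, Complex.ofReal_neg, neg_smul, neg_neg]
  · rw [smul_spectralMatrix, exp_spectralMatrix]
    refine b.matrix_ext fun j => ?_
    rw [b.toEuclideanLin_spectralMatrix, hbU]
    congr 1
    exact (hθ _).symm
  · simp only [lam]
    rcases e.symm j with i | i <;> simp [hl]
  · have hjk : j < k := by omega
    have e1 : (⟨j, by omega⟩ : Fin N) = e (Sum.inl ⟨j, hjk⟩) := Fin.ext (by simp [e])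
    have e2 : (⟨N / 2 + j, by omega⟩ : Fin N) = e (Sum.inr ⟨j, hjk⟩) :=
      Fin.ext (by simp [e]; omega)
    rw [e1, e2]
    refine ⟨?_, ?_, ?_⟩
    · simp [b, hcΓ]
    · simp [lam]
    · simp [μ, θ]

end Floquet

theorem mainTheorem2 (N : ℕ) (T : ℝ) (hT : 0 < T)
    (Γ : Matrix (Fin N) (Fin N) ℂ)
    (hΓ_unitary : Γ ∈ Matrix.unitaryGroup (Fin N) ℂ)
    (hΓ_sq : Γ * Γ = 1)
    (hΓ_balanced :
      Module.finrank ℂ (Module.End.eigenspace (Matrix.toLin' Γ) (1 : ℂ)) =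
        Module.finrank ℂ (Module.End.eigenspace (Matrix.toLin' Γ) (-1 : ℂ)))
    (H : ℝ → Matrix (Fin N) (Fin N) ℂ)
    (hH_int : ∀ j k : Fin N, MeasureTheory.LocallyIntegrable (fun t => H t j k))
    (hH_herm : ∀ t, (H t).IsHermitian)
    (hH_periodic : Function.Periodic H T)
    (hH_chiral : ∀ t, Γ * H t * Γ = -H (-t))
    (U : ℝ → Matrix (Fin N) (Fin N) ℂ)
    (hU : IsTimeEvolution H U) :
    ∃ H_F : Matrix (Fin N) (Fin N) ℂ,
      H_F.IsHermitian ∧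
      Γ * H_F = -(H_F * Γ) ∧
      NormedSpace.exp (-Complex.I • H_F) = U T ∧
      ∃ (b : OrthonormalBasis (Fin N) ℂ (EuclideanSpace ℂ (Fin N)))
        (lam : Fin N → ℂ) (μ : Fin N → ℝ),
        (∀ j, ‖lam j‖ = 1 ∧
          Matrix.toEuclideanLin (U T) (b j) = lam j • b j ∧
          Matrix.toEuclideanLin H_F (b j) = (μ j : ℂ) • b j ∧
          lam j = Complex.exp (-Complex.I * (μ j : ℂ))) ∧
        ∀ (j : ℕ) (hj : j < N / 2),
          Matrix.toEuclideanLin Γ (b ⟨j, by omega⟩) = b ⟨N / 2 + j, by omega⟩ ∧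
          (starRingEnd ℂ) (lam ⟨j, by omega⟩) = lam ⟨N / 2 + j, by omega⟩ ∧
          μ ⟨N / 2 + j, by omega⟩ = -μ ⟨j, by omega⟩ := by
  have hunit := hU.conjTranspose_mul_self hH_int hH_herm
  have hfloq := hU.floquet_eq hH_int hH_herm hH_periodic hΓ_sq hH_chiral
  set F := U (T / 2) with hF
  have hFF : F * F.conjTranspose = 1 := mul_eq_one_comm.mp (hunit (T / 2))
  -- The second involution, conjugate to `Γ` by the unitary `F`, so that it inherits both its square
  -- and its trace.
  have hΓU : Γ * U T = F.conjTranspose * Γ * F := by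
    rw [hfloq]
    simp only [← Matrix.mul_assoc, hΓ_sq, Matrix.one_mul]
  obtain ⟨htr, hdim⟩ := trace_eq_zero_of_balanced_involution (f := Matrix.toLin' Γ)
    (fun x => by rw [← Matrix.toLin'_mul_apply, hΓ_sq, Matrix.toLin'_one, LinearMap.id_apply])
    hΓ_balanced
  rw [Matrix.trace_toLin'_eq] at htr
  rw [Module.finrank_fintype_fun_eq_card, Fintype.card_fin] at hdim
  refine (isChiralPair_toEuclideanLin (Matrix.mem_unitaryGroup_iff'.mp hΓ_unitary) hΓ_sq htr
    (hunit T) ?_ ?_).exists_log hdim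
  · calc Γ * U T * (Γ * U T) = F.conjTranspose * (Γ * (F * F.conjTranspose) * Γ) * F := by
          rw [hΓU]
          simp only [Matrix.mul_assoc]
      _ = 1 := by rw [hFF, Matrix.mul_one, hΓ_sq, Matrix.mul_one, hunit (T / 2)]
  · rw [hΓU, Matrix.trace_mul_comm, ← Matrix.mul_assoc, hFF, Matrix.one_mul, htr]
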